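/- **The scheme $\mathrm{pWSAh}$.** There are $M$ agents $1,\dots,M$, an aggregator $a$ and $T$ time steps, where $M$ and $T$ are constants or, more generally, are bounded by polynomials in the security parameter $\kappa$. - $\mathrm{Setup}$: generate (with an arbitrary distribution) two primes $p,q$ with the same number of bits such that $N=pq$ satisfies $\lfloor\log_2N\rfloor=\kappa$ and $\gcd(\phi(N),N)=1$ (the condition $\lfloor\log_2N\rfloor=\kappa$ is required for all sufficiently large $\kappa$, since for some small $\kappa$ there are no such primes). For all $i\in[M]$ and $t\in[T]$ draw $s_i(t)\in(\mathbb Z/N\mathbb Z)^*$ uniformly and independently, and set $s_a(t)=-\sum_{i\in[M]}s_i(t)\in\mathbb Z/N\mathbb Z$. Put $\mathrm{prm}=(\kappa,N)$, $\mathrm{sk}_i=(s_i(t))_{t\in[T]}$ and $\mathrm{sk}_a=\big((\phi(N),\phi(N)^{-1}\bmod N),(s_a(t))_{t\in[T]}\big)$. - Paillier encryption of $x\in\mathbb Z/N\mathbb Z$ is $\mathrm E(x)=(1+N)^xr^N\bmod N^2$ with a fresh uniform $r\in(\mathbb Z/N\mathbb Z)^*$; decryption is $\mathrm D(c)=\frac{(c^{\phi(N)}\bmod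 N^2)-1}{N}\,\phi(N)^{-1}\bmod N$. - $\mathrm{InitW}$: for a weight $w_i\in\mathbb Z/N\mathbb Z$ of agent $i$, output $\mathrm{sw}_i=\mathrm E(w_i)$. - $\mathrm{Enc}$: for $x_i(t)\in\mathbb Z/N\mathbb Z$, output $c_i(t)=\mathrm{sw}_i^{\,x_i(t)}\cdot\mathrm E(s_i(t))\bmod N^2$. - $\mathrm{AggrDec}$: output $x_a(t)=\mathrm D\big(\prod_{i\in[M]}c_i(t)\big)+s_a(t)\bmod N$. **The game $\mathrm{pWSAO}$.** The challenger runs $\mathrm{Setup}$ and gives $\mathrm{prm}$ to the adversary $\mathcal A$, a randomized interactive algorithm. At any time $\mathcal A$ may adaptively make - compromise queries: it names a participant $j\in[M]\cup\{a\}$ and receives $\mathrm{sk}_j$; $\mathcal C$ denotes the set of participants compromised by the end of the game; - encryption queries $(i,t,\{w_i^0,w_i^1\},x)$ with $i\in[M]$: it receives $\mathrm{Enc}$ of $x$ for agent $i$ at time $t$, once under $\mathrm{InitW}(w_i^0)$ and once under $\mathrm{InitW}(w_i^1)$; $\mathcal E(t)$ denotes the set of agents queried at time $t$ by the end of the game.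 At most one such query is allowed for each pair $(i,t)$. Once in the game, $\mathcal A$ submits a challenge: a time step $t^*$, a set $\mathcal S^*\subseteq\mathcal U^*:=([M]\cup\{a\})\setminus(\mathcal C\cup\mathcal E(t^*))$, and for each agent $i\in\mathcal S^*\setminus\{a\}$ two weights $w_i^0,w_i^1$ and two values $x_i^0,x_i^1$. The two weights of an agent must be the same in all encryption queries and in the challenge. If $\mathcal S^*=\mathcal U^*$ and $a\notin\mathcal S^*$, then it is required that $\sum_{i\in\mathcal S^*}w_i^0x_i^0=\sum_{i\in\mathcal S^*}w_i^1x_i^1$ in $\mathbb Z/N\mathbb Z$. The challenger draws a uniform bit $b$ and returns $\mathrm{Enc}$ of $x_i^b$ for agent $i$ at time $t^*$ under $\mathrm{InitW}(w_i^b)$, for all agents $i\in\mathcal S^*\setminus\{a\}$. At the end $\mathcal A$ outputs a guess $b'\in\{0,1\}$; if one of the rules was violated, $b'$ is replaced by a fair coin toss. The advantage of $\mathcal A$ is $\mathrm{Adv}(\mathcal A)=\left|\Pr[b'=b]-\tfrac12\right|$. **Theorem.** The scheme $\mathrm{pWSAh}$ achieves weighted sum aggregator obliviousness: for every adversary $\mathcal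 A$ (in particular for every probabilistic polynomial-time one, but no bound on its computational power is needed), which may compromise the aggregator and any set of agents, there is a negligible function $\eta$ such that $\mathrm{Adv}(\mathcal A)\le\eta(\kappa)$ for all $\kappa$. Here $\eta$ is negligible if for every real $c>0$ there is $n_c$ with $|\eta(n)|\le n^{-c}$ for all integers $n\ge n_c$. -/

import Mathlib

namespace PWSA

/-! ### Asymptotics -/

/-- A function `η` of the security parameter is negligible if it is eventually
bounded by `n ^ (-c)`, for every real `c > 0`. -/
def Negligible (η : ℕ → ℝ) : Prop :=
  ∀ c : ℝ, 0 < c → ∃ n₀ : ℕ, 1 ≤ n₀ ∧ ∀ n : ℕ, n₀ ≤ n → |η n| ≤ (n : ℝ) ^ (-c)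

/-- A size parameter is bounded by a polynomial in the security parameter
(every constant is). -/
def PolyBounded (f : ℕ → ℕ) : Prop :=
  ∃ P : Polynomial ℕ, ∀ κ : ℕ, f κ ≤ P.eval κ

/-- Independent samples from a finite family of distributions. -/
noncomputable def indep {α : Type} : {n : ℕ} → (Fin n → PMF α) → PMF (Fin n → α)
  | 0, _ => PMF.pure Fin.elim0
  | _ + 1, p => (p 0).bind fun a => (indep fun i => p i.succ).map (Fin.cons a)

/-! ### Private weighted sum aggregation schemes with hidden weights -/

/-- Syntax of a private weighted sum aggregation scheme with hidden weights, for a fixed security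
parameter, `M` agents and `T` time steps.  The spaces may depend on the public
parameters (for instance on a modulus contained in them). -/
structure Scheme (M T : ℕ) where
  /-- public parameters `prm` -/
  Prm : Type
  /-- space of local values and of weights -/
  Msg : Prm → Type
  [ring : ∀ prm, CommRing (Msg prm)]
  /-- space of the agents' secret information `sk_i` -/
  AgentKey : Prm → Type
  /-- space of the aggregator's secret information `sk_a` -/
  AggrKey : Prm → Type
  /-- space of the protected weights `sw_i` -/
  HiddenWeight : Prm → Type
  /-- space of ciphertexts -/
  Cipher : Prm → Type
  /-- `Setup`, which outputs `prm`, all `sk_i`, and `sk_a` -/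
  setup : PMF (Σ prm : Prm, (Fin M → AgentKey prm) × AggrKey prm)
  /-- `InitW(prm, i, w)` -/
  initW : (prm : Prm) → Fin M → Msg prm → PMF (HiddenWeight prm)
  /-- `Enc(prm, sw_i, sk_i, t, x)` -/
  enc : (prm : Prm) → HiddenWeight prm → AgentKey prm → Fin T → Msg prm → PMF (Cipher prm)
  /-- `AggrDec(prm, sk_a, t, (c_i)_i)` -/
  aggrDec : (prm : Prm) → AggrKey prm → Fin T → (Fin M → Cipher prm) → Msg prm

attribute [instance] Scheme.ring

/-! ### The adversary's side of the game

Participants are `Option (Fin M)`: `some i` is agent `i`, `none` is the aggregator. -/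

/-- An encryption query `(i, t, {w⁰, w¹}, x)`; `w false` is `w⁰` and `w true` is `w¹`. -/
structure EncQuery (M T : ℕ) (X : Type) where
  agent : Fin M
  time : Fin T
  w : Bool → X
  x : X

/-- A challenge: the time step `t⋆`, the set `S⋆` of participants, and for each bit the
weights and values of the agents (only those of the agents in `S⋆` matter). -/
structure Challenge (M T : ℕ) (X : Type) where
  time : Fin T
  S : Finset (Option (Fin M))
  w : Bool → Fin M → X
  x : Bool → Fin M → X

/-- A randomized interactive algorithm that may toss coins, compromise agents and the
aggregator, make encryption queries (each answered by two ciphertexts, one per weight), all of it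
adaptively, and that finally outputs an element of `R`.
Here `X`, `K`, `KA`, `C` are the spaces of values, agents' keys, aggregator's keys, ciphertexts.
No bound is put on the computational power, so that every probabilistic
polynomial-time algorithm is covered. -/
inductive Interaction (M T : ℕ) (X K KA C R : Type) : Type
  | output (r : R)
  | sample (p : PMF ℕ) (next : ℕ → Interaction M T X K KA C R)
  | compromiseAgent (i : Fin M) (next : K → Interaction M T X K KA C R)
  | compromiseAggregator (next : KA → Interaction M T X K KA C R)
  | encrypt (q : EncQuery M T X) (next : C × C → Interaction M T X K KA C R)

/-- An interaction with a given scheme and given public parameters. -/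
abbrev Scheme.Interacts {M T : ℕ} (𝒮 : Scheme M T) (prm : 𝒮.Prm) (R : Type) : Type :=
  Interaction M T (𝒮.Msg prm) (𝒮.AgentKey prm) (𝒮.AggrKey prm) (𝒮.Cipher prm) R

/-- The answer to a challenge: a ciphertext for each agent in `S⋆`, nothing for the others. -/
abbrev Scheme.Answer {M T : ℕ} (𝒮 : Scheme M T) (prm : 𝒮.Prm) : Type :=
  Fin M → Option (𝒮.Cipher prm)

/-- An adversary: given the public parameters, it makes queries, then submits one challenge; given
the answer, it may make further queries, and outputs its guess. -/
abbrev Scheme.Adversary {M T : ℕ} (𝒮 : Scheme M T) : Type :=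
  (prm : 𝒮.Prm) →
    𝒮.Interacts prm (Challenge M T (𝒮.Msg prm) × (𝒮.Answer prm → 𝒮.Interacts prm Bool))

/-- What the challenger records: the set `𝒞` of compromised participants and the
encryption queries. -/
structure Log (M T : ℕ) (X : Type) where
  corrupted : Finset (Option (Fin M))
  queries : List (EncQuery M T X)

namespace Log

variable {M T : ℕ} {X : Type}

/-- The log at the beginning of the game. -/
def empty : Log M T X := ⟨∅, []⟩

/-- Record that participant `j` is compromised. -/
def corrupt (L : Log M T X) (j : Option (Fin M)) : Log M T X :=
  ⟨insert j L.corrupted, L.queries⟩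

/-- Record an encryption query. -/
def record (L : Log M T X) (q : EncQuery M T X) : Log M T X :=
  ⟨L.corrupted, q :: L.queries⟩

/-- The set `ℰ(t)` of participants for which an encryption query was made at time `t`. -/
def encrypted (L : Log M T X) (t : Fin T) : Finset (Option (Fin M)) :=
  ((L.queries.filter fun q => q.time = t).map fun q => some q.agent).toFinset

/-- The set `𝒰⋆ = ([M] ∪ {a}) \ (𝒞 ∪ ℰ(t⋆))`. -/
def untouched (L : Log M T X) (t : Fin T) : Finset (Option (Fin M)) :=
  Finset.univ \ (L.corrupted ∪ L.encrypted t)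

end Log

/-- The rules of the game, checked on the log at the end of the game. -/
structure Legal {M T : ℕ} {X : Type} [CommRing X] (ch : Challenge M T X) (L : Log M T X) :
    Prop where
  /-- at most one encryption query per agent and time step -/
  once : (L.queries.map fun q => (q.agent, q.time)).Nodup
  /-- the two weights of each agent are constant over the encryption queries … -/
  weights : ∀ q ∈ L.queries, ∀ q' ∈ L.queries, q.agent = q'.agent → q.w = q'.w
  /-- … and are those used in the challenge -/
  challengeWeights : ∀ q ∈ L.queries, some q.agent ∈ ch.S → ∀ b, q.w b = ch.w b q.agent
  /-- `S⋆ ⊆ 𝒰⋆` -/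
  subset : ch.S ⊆ L.untouched ch.time
  /-- equal weighted sums, if `S⋆ = 𝒰⋆` and the aggregator is not in `S⋆` -/
  balanced : ch.S = L.untouched ch.time → none ∉ ch.S →
    ∑ i with some i ∈ ch.S, ch.w false i * ch.x false i =
      ∑ i with some i ∈ ch.S, ch.w true i * ch.x true i

/-! ### The challenger's side of the game -/

namespace Scheme

variable {M T : ℕ} (𝒮 : Scheme M T)

/-- A fresh protection of the weight `w` of agent `i`, followed by the encryption of `x`. -/
noncomputable def freshEnc (prm : 𝒮.Prm) (sk : Fin M → 𝒮.AgentKey prm) (i : Fin M) (t : Fin T)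
    (w x : 𝒮.Msg prm) : PMF (𝒮.Cipher prm) :=
  (𝒮.initW prm i w).bind fun sw => 𝒮.enc prm sw (sk i) t x

/-- Execution of an interaction against the challenger, who holds all the secret keys. -/
noncomputable def run {R : Type} (prm : 𝒮.Prm) (sk : Fin M → 𝒮.AgentKey prm)
    (ska : 𝒮.AggrKey prm) :
    𝒮.Interacts prm R → Log M T (𝒮.Msg prm) → PMF (R × Log M T (𝒮.Msg prm))
  | .output r, L => PMF.pure (r, L)
  | .sample p next, L => p.bind fun n => run prm sk ska (next n) L
  | .compromiseAgent i next, L => run prm sk ska (next (sk i)) (L.corrupt (some i))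
  | .compromiseAggregator next, L => run prm sk ska (next ska) (L.corrupt none)
  | .encrypt q next, L =>
      (𝒮.freshEnc prm sk q.agent q.time (q.w false) q.x).bind fun c₀ =>
        (𝒮.freshEnc prm sk q.agent q.time (q.w true) q.x).bind fun c₁ =>
          run prm sk ska (next (c₀, c₁)) (L.record q)

/-- The challenger's answer to a challenge, for the bit `b`. -/
noncomputable def answer (prm : 𝒮.Prm) (sk : Fin M → 𝒮.AgentKey prm)
    (ch : Challenge M T (𝒮.Msg prm)) (b : Bool) : PMF (𝒮.Answer prm) :=
  indep fun i =>
    if some i ∈ ch.S then (𝒮.freshEnc prm sk i ch.time (ch.w b i) (ch.x b i)).map some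
    else PMF.pure none

open Classical in
/-- The game; the outcome `true` means that the guess is correct.
A play against the rules is worth a fair coin toss, i.e. it gives no advantage. -/
noncomputable def game (A : 𝒮.Adversary) : PMF Bool :=
  𝒮.setup.bind fun keys =>
    (𝒮.run keys.1 keys.2.1 keys.2.2 (A keys.1) Log.empty).bind fun s =>
      (PMF.uniformOfFintype Bool).bind fun b =>
        (𝒮.answer keys.1 keys.2.1 s.1.1 b).bind fun c =>
          (𝒮.run keys.1 keys.2.1 keys.2.2 (s.1.2 c) s.2).bind fun g =>
            if Legal s.1.1 g.2 then PMF.pure (g.1 == b) else PMF.uniformOfFintype Bool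

/-- The advantage `|Pr[b' = b] - 1/2|`. -/
noncomputable def advantage (A : 𝒮.Adversary) : ℝ :=
  |(𝒮.game A true).toReal - 1 / 2|

end Scheme

/-- Weighted sum aggregator obliviousness of a scheme (a family indexed by the security
parameter `κ`): no adversary has more than negligible advantage.  The adversaries
are all randomized interactive algorithms, whatever their running time. -/
def AggregatorOblivious {M T : ℕ → ℕ} (𝒮 : (κ : ℕ) → Scheme (M κ) (T κ)) : Prop :=
  ∀ A : (κ : ℕ) → (𝒮 κ).Adversary,
    ∃ η : ℕ → ℝ, Negligible η ∧ ∀ κ, (𝒮 κ).advantage (A κ) ≤ η κ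

/-! ### The Paillier cryptosystem -/

/-- Two primes of equal size (number of bits) whose product `N` satisfies `gcd(φ(N), N) = 1`. -/
structure PaillierPrimes where
  p : ℕ
  q : ℕ
  prime_p : p.Prime
  prime_q : q.Prime
  equal_size : p.size = q.size
  coprime : Nat.gcd (Nat.totient (p * q)) (p * q) = 1

/-- The modulus `N = p q`. -/
def PaillierPrimes.modulus (k : PaillierPrimes) : ℕ+ :=
  ⟨k.p * k.q, Nat.mul_pos k.prime_p.pos k.prime_q.pos⟩

/-- `E(x; r) = (1 + N) ^ x * r ^ N mod N²`. -/
def paillierEncWith (N : ℕ+) (x : ZMod N) (r : (ZMod N)ˣ) : ZMod ((N : ℕ) ^ 2) :=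
  (1 + ((N : ℕ) : ZMod ((N : ℕ) ^ 2))) ^ x.val *
    (((r : ZMod N).val : ℕ) : ZMod ((N : ℕ) ^ 2)) ^ (N : ℕ)

/-- `E(x)`, with `r` uniform in `(ℤ/N)ˣ`. -/
noncomputable def paillierEnc (N : ℕ+) (x : ZMod N) : PMF (ZMod ((N : ℕ) ^ 2)) :=
  (PMF.uniformOfFintype (ZMod N)ˣ).map (paillierEncWith N x)

/-- The secret key `(φ(N), φ(N)⁻¹ mod N)`. -/
def paillierSecret (N : ℕ+) : ℕ × ZMod N :=
  (Nat.totient N, ((Nat.totient N : ℕ) : ZMod N)⁻¹)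

/-- `D(c) = (c ^ φ(N) - 1) / N * φ(N)⁻¹ mod N`. -/
def paillierDec (N : ℕ+) (sec : ℕ × ZMod N) (c : ZMod ((N : ℕ) ^ 2)) : ZMod N :=
  ((((c ^ sec.1).val - 1) / (N : ℕ) : ℕ) : ZMod N) * sec.2

/-! ### The scheme -/

/-- The aggregator's shares `s_a(t) = - ∑ i, s_i(t)`. -/
def aggregatorShare {M T : ℕ} (N : ℕ+) (s : Fin M → Fin T → (ZMod N)ˣ) (t : Fin T) : ZMod N :=
  -∑ i, (s i t : ZMod N)

/-- The scheme with Paillier-encrypted weights and with fresh shares of zero in each time step, for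
the security parameter `κ` and the distribution `gen` of the two primes.  The
public parameters are `(κ, N)`; the shares `s_i(t)` are independent and uniform in `(ℤ/N)ˣ`. -/
noncomputable def pWSAh (gen : PMF PaillierPrimes) (κ M T : ℕ) : Scheme M T where
  Prm := ℕ × ℕ+
  Msg prm := ZMod prm.2
  ring _ := inferInstance
  AgentKey prm := Fin T → (ZMod prm.2)ˣ
  AggrKey prm := (ℕ × ZMod prm.2) × (Fin T → ZMod prm.2)
  HiddenWeight prm := ZMod ((prm.2 : ℕ) ^ 2)
  Cipher prm := ZMod ((prm.2 : ℕ) ^ 2)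
  setup := gen.bind fun k =>
    (PMF.uniformOfFintype (Fin M → Fin T → (ZMod k.modulus)ˣ)).map fun s =>
      ⟨(κ, k.modulus), s, (paillierSecret k.modulus, aggregatorShare k.modulus s)⟩
  initW prm _ w := paillierEnc prm.2 w
  enc prm sw sk t x := (paillierEnc prm.2 (sk t : ZMod prm.2)).map fun c => sw ^ x.val * c
  aggrDec prm ska t c := paillierDec prm.2 ska.1 (∏ i, c i) + ska.2 t

end PWSA

/-!
Paillier encryption is homomorphic and re-randomizing, so a ciphertext of agent `i` at time `t` is
a fresh encryption of `w * x + s_i(t)`, in which the share `s_i(t)` acts as a one-time pad.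

Suppose first that the shares are uniform in `ℤ/N`. Fix the transcript of a legal play. Shifting
the shares at time `t⋆` by the difference of the two challenge plaintexts turns the challenge for
one bit into the challenge for the other. The shift may be taken to vanish on everything the
adversary has seen: if the aggregator is compromised, its components must add up to zero, which
holds by the balance rule when `S⋆ = 𝒰⋆`, and otherwise can be arranged with an agent of
`𝒰⋆ \ S⋆`. So the transcript is equally likely for both bits, and the game is a fair coin toss.

The shares of the scheme are uniform in the units of `ℤ/N` instead. The families of units have
density `(φ(N) / N) ^ (M * T)` among all families, so the restriction to them costs at most
`1 - (φ(N) / N) ^ (M * T) ≤ M * T * (1 / p + 1 / q)`, where `p` and `q` are about `√N`.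
-/

namespace PWSA

open Filter Asymptotics

/-! ### Probability mass functions -/

section PMF

variable {α β γ : Type*}

theorem bind_apply_congr {p q : PMF α} {f g : α → PMF β} {b : β}
    (h : ∀ a, b ∈ (f a).support ∨ b ∈ (g a).support → p a = q a ∧ f a b = g a b) :
    p.bind f b = q.bind g b := by
  simp only [PMF.bind_apply]
  refine tsum_congr fun a => ?_
  by_cases hb : b ∈ (f a).support ∨ b ∈ (g a).support
  · rw [(h a hb).1, (h a hb).2]
  · obtain ⟨hf, hg⟩ := not_or.1 hb
    rw [(PMF.apply_eq_zero_iff _ _).2 hf, (PMF.apply_eq_zero_iff _ _).2 hg, mul_zero, mul_zero]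

theorem toReal_bind_apply_le {p : PMF α} {f : α → PMF β} {b : β} {c : ℝ}
    (h : ∀ a ∈ p.support, (f a b).toReal ≤ c) : (p.bind f b).toReal ≤ c := by
  obtain ⟨a₀, ha₀⟩ := p.support_nonempty
  refine ENNReal.toReal_le_of_le_ofReal (ENNReal.toReal_nonneg.trans (h a₀ ha₀)) ?_
  have hterm : ∀ a, p a * f a b ≤ p a * ENNReal.ofReal c := fun a => by
    by_cases ha : a ∈ p.support
    · gcongr
      exact (ENNReal.le_ofReal_iff_toReal_le (PMF.apply_ne_top _ _)
        (ENNReal.toReal_nonneg.trans (h a ha))).2 (h a ha)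
    · simp [(PMF.apply_eq_zero_iff p a).2 ha]
  calc p.bind f b ≤ ∑' a, p a * ENNReal.ofReal c := ENNReal.tsum_le_tsum hterm
    _ = ENNReal.ofReal c := by rw [ENNReal.tsum_mul_right, PMF.tsum_coe, one_mul]

section Uniform

variable [Fintype α] [Nonempty α] [Fintype β] [Nonempty β]

theorem uniformOfFintype_map_equiv (e : α ≃ β) :
    (PMF.uniformOfFintype α).map e = PMF.uniformOfFintype β := by
  ext b
  rw [PMF.map_apply, tsum_eq_single (e.symm b)]
  · simp [Fintype.card_congr e]
  · exact fun a ha => if_neg fun h => ha (e.eq_symm_apply.2 h.symm)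

theorem toReal_uniformOfFintype_bind_apply (f : α → PMF γ) (c : γ) :
    ((PMF.uniformOfFintype α).bind f c).toReal = (∑ a, (f a c).toReal) / Fintype.card α := by
  rw [PMF.bind_apply, tsum_fintype, ENNReal.toReal_sum fun a _ =>
    ENNReal.mul_ne_top (PMF.apply_ne_top _ _) (PMF.apply_ne_top _ _)]
  simp [← Finset.mul_sum, div_eq_inv_mul]

theorem toReal_uniformOfFintype_bind_embedding_le (e : α ↪ β) (f : β → PMF γ) (c : γ) :
    ((PMF.uniformOfFintype α).bind (fun a => f (e a)) c).toReal ≤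
      ((PMF.uniformOfFintype β).bind f c).toReal +
        (1 - (Fintype.card α : ℝ) / Fintype.card β) := by
  set P := ((PMF.uniformOfFintype α).bind (fun a => f (e a)) c).toReal with hP
  set Q := ((PMF.uniformOfFintype β).bind f c).toReal with hQ
  set y := (Fintype.card α : ℝ) / Fintype.card β with hy
  have hα : (Fintype.card α : ℝ) ≠ 0 := by exact_mod_cast Fintype.card_ne_zero
  have hP_le_one : P ≤ 1 := by
    simpa using ENNReal.toReal_mono ENNReal.one_ne_top (PMF.coe_le_one _ c)
  have hy_le_one : y ≤ 1 :=
    div_le_one_of_le₀ (by exact_mod_cast Fintype.card_le_of_embedding e) (Nat.cast_nonneg _)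
  have hPy : P * y ≤ Q := by
    rw [hP, hQ, hy, toReal_uniformOfFintype_bind_apply, toReal_uniformOfFintype_bind_apply,
      div_mul_div_cancel₀ hα, ← Finset.sum_map Finset.univ e fun b => (f b c).toReal]
    gcongr
    exact Finset.subset_univ _
  linarith [mul_le_of_le_one_left (sub_nonneg.2 hy_le_one) hP_le_one]

end Uniform

theorem abs_toReal_apply_true_sub_half_le {p : PMF Bool} {ε : ℝ}
    (h : ∀ v, (p v).toReal ≤ 1 / 2 + ε) : |(p true).toReal - 1 / 2| ≤ ε := by
  have hsum : (p true).toReal + (p false).toReal = 1 := by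
    rw [← ENNReal.toReal_add (PMF.apply_ne_top _ _) (PMF.apply_ne_top _ _), ← Fintype.sum_bool,
      ← tsum_fintype (L := .unconditional _), PMF.tsum_coe, ENNReal.toReal_one]
  rw [abs_le]
  constructor <;> linarith [h true, h false]

end PMF

section GuessGame

variable {α Ω : Type*} {legal : Ω → Prop} {guess : Ω → Bool}

open Classical in
/-- The game of guessing a uniform bit `b` from a play with law `Q b`; the outcome `true` means
that the guess is correct, and an illegal play is worth a fair coin toss. -/
noncomputable def guessGame (legal : Ω → Prop) (guess : Ω → Bool) (Q : Bool → PMF Ω) : PMF Bool :=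
  (PMF.uniformOfFintype Bool).bind fun b => (Q b).bind fun o =>
    if legal o then PMF.pure (guess o == b) else PMF.uniformOfFintype Bool

theorem bind_guessGame (p : PMF α) (Q : α → Bool → PMF Ω) :
    (p.bind fun a => guessGame legal guess (Q a)) =
      guessGame legal guess fun b => p.bind fun a => Q a b := by
  simp only [guessGame, PMF.bind_bind]
  exact PMF.bind_comm _ _ _

theorem guessGame_eq_uniform {Q : Bool → PMF Ω} (h : ∀ o, legal o → Q false o = Q true o) :
    guessGame legal guess Q = PMF.uniformOfFintype Bool := by
  classical
  ext v
  let verdict (o : Ω) (b : Bool) : PMF Bool :=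
    if legal o then PMF.pure (guess o == b) else PMF.uniformOfFintype Bool
  have hverdict : ∀ o, Q true o * verdict o true v + Q false o * verdict o false v =
      (Q true o + Q false o) * 2⁻¹ := fun o => by
    by_cases ho : legal o
    · have hhalf : Q true o = (Q true o + Q true o) * 2⁻¹ := by
        rw [← mul_two, mul_assoc, ENNReal.mul_inv_cancel two_ne_zero ENNReal.ofNat_ne_top, mul_one]
      rw [h o ho, ← hhalf]
      cases hg : guess o <;> cases v <;> simp [verdict, ho, hg, PMF.pure_apply]
    · simp [verdict, ho, add_mul]
  calc guessGame legal guess Q v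
      = 2⁻¹ * ∑' o, (Q true o * verdict o true v + Q false o * verdict o false v) := by
        simp [guessGame, verdict, PMF.bind_apply, ENNReal.tsum_add, mul_add]
    _ = 2⁻¹ * ((1 + 1) * 2⁻¹) := by
        simp only [hverdict, ENNReal.tsum_mul_right, ENNReal.tsum_add, PMF.tsum_coe]
    _ = PMF.uniformOfFintype Bool v := by
        rw [one_add_one_eq_two, ENNReal.mul_inv_cancel two_ne_zero ENNReal.ofNat_ne_top, mul_one]
        simp

end GuessGame

/-! ### Interactions with an abstract challenger -/

/-- What an interaction can obtain from a challenger: the secret information of each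
participant, and the law of the encryption of `x` under the weight `w` for each agent and time. -/
structure Oracle (M T : ℕ) (X K KA C : Type) where
  key : Fin M → K
  aggr : KA
  enc : Fin M → Fin T → X → X → PMF C

/-- The record of a complete play. -/
structure Transcript (M T : ℕ) (X : Type) where
  challenge : Challenge M T X
  guess : Bool
  log : Log M T X

/-- The type `Scheme.Adversary` for fixed public parameters, in terms of the spaces of values,
agents' keys, aggregator's keys and ciphertexts. -/
abbrev Player (M T : ℕ) (X K KA C : Type) : Type :=
  Interaction M T X K KA C
    (Challenge M T X × ((Fin M → Option C) → Interaction M T X K KA C Bool))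

section Oracle

variable {M T : ℕ} {X K KA C R : Type}

/-- `L ≤ L'` means that everything recorded in `L` is recorded in `L'`. -/
instance : Preorder (Log M T X) where
  le L L' := L.corrupted ⊆ L'.corrupted ∧ L.queries ⊆ L'.queries
  le_refl _ := ⟨Finset.Subset.refl _, List.Subset.refl _⟩
  le_trans _ _ _ h h' := ⟨Finset.Subset.trans h.1 h'.1, List.Subset.trans h.2 h'.2⟩

theorem Log.le_corrupt (L : Log M T X) (j : Option (Fin M)) : L ≤ L.corrupt j :=
  ⟨Finset.subset_insert _ _, List.Subset.refl _⟩

theorem Log.le_record (L : Log M T X) (q : EncQuery M T X) : L ≤ L.record q :=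
  ⟨Finset.Subset.refl _, List.subset_cons_self _ _⟩

namespace Oracle

/-- Execution of an interaction against an abstract challenger, as in `Scheme.run`. -/
noncomputable def run (O : Oracle M T X K KA C) :
    Interaction M T X K KA C R → Log M T X → PMF (R × Log M T X)
  | .output r, L => PMF.pure (r, L)
  | .sample p next, L => p.bind fun n => run O (next n) L
  | .compromiseAgent i next, L => run O (next (O.key i)) (L.corrupt (some i))
  | .compromiseAggregator next, L => run O (next O.aggr) (L.corrupt none)
  | .encrypt q next, L =>
      (O.enc q.agent q.time (q.w false) q.x).bind fun c₀ =>
        (O.enc q.agent q.time (q.w true) q.x).bind fun c₁ =>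
          run O (next (c₀, c₁)) (L.record q)

/-- The answer to a challenge, for the bit `b`, as in `Scheme.answer`. -/
noncomputable def answer (O : Oracle M T X K KA C) (ch : Challenge M T X) (b : Bool) :
    PMF (Fin M → Option C) :=
  indep fun i =>
    if some i ∈ ch.S then (O.enc i ch.time (ch.w b i) (ch.x b i)).map some else PMF.pure none

/-- The part of a play that follows the submission of the challenge `ch`. -/
noncomputable def finish (O : Oracle M T X K KA C) (ch : Challenge M T X)
    (next : (Fin M → Option C) → Interaction M T X K KA C Bool) (L : Log M T X) (b : Bool) :
    PMF (Transcript M T X) :=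
  (O.answer ch b).bind fun c => (O.run (next c) L).bind fun g => PMF.pure ⟨ch, g.1, g.2⟩

/-- A complete play, for the bit `b`. -/
noncomputable def play (O : Oracle M T X K KA C) (I : Player M T X K KA C) (b : Bool) :
    PMF (Transcript M T X) :=
  (O.run I Log.empty).bind fun s => O.finish s.1.1 s.1.2 s.2 b

/-- The game against an abstract challenger, as in `Scheme.game`. -/
noncomputable def game [CommRing X] (O : Oracle M T X K KA C) (I : Player M T X K KA C) :
    PMF Bool :=
  guessGame (fun τ : Transcript M T X => Legal τ.challenge τ.log) Transcript.guess (O.play I)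

/-- Two challengers agree on everything that is recorded in a log. -/
structure AgreeOn (O O' : Oracle M T X K KA C) (L : Log M T X) : Prop where
  key : ∀ i, some i ∈ L.corrupted → O.key i = O'.key i
  aggr : none ∈ L.corrupted → O.aggr = O'.aggr
  enc : ∀ q ∈ L.queries, O.enc q.agent q.time = O'.enc q.agent q.time

variable {O O' : Oracle M T X K KA C}

theorem AgreeOn.mono {L L' : Log M T X} (h : O.AgreeOn O' L') (hL : L ≤ L') : O.AgreeOn O' L :=
  ⟨fun i hi => h.key i (hL.1 hi), fun hi => h.aggr (hL.1 hi), fun q hq => h.enc q (hL.2 hq)⟩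

theorem le_of_mem_support_run {I : Interaction M T X K KA C R} {L : Log M T X}
    {s : R × Log M T X} (h : s ∈ (O.run I L).support) : L ≤ s.2 := by
  induction I generalizing L with
  | output r =>
    simp only [run, PMF.support_pure, Set.mem_singleton_iff] at h
    exact h ▸ le_rfl
  | sample p next ih =>
    simp only [run, PMF.mem_support_bind_iff] at h
    obtain ⟨n, -, hn⟩ := h
    exact ih n hn
  | compromiseAgent i next ih => exact (L.le_corrupt _).trans (ih _ h)
  | compromiseAggregator next ih => exact (L.le_corrupt _).trans (ih _ h)
  | encrypt q next ih =>
    simp only [run, PMF.mem_support_bind_iff] at h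
    obtain ⟨c₀, -, c₁, -, hc⟩ := h
    exact (L.le_record _).trans (ih _ hc)

theorem run_apply_eq_zero {I : Interaction M T X K KA C R} {L : Log M T X}
    {s : R × Log M T X} (h : ¬ L ≤ s.2) : O.run I L s = 0 :=
  (PMF.apply_eq_zero_iff _ _).2 fun hs => h (le_of_mem_support_run hs)

theorem AgreeOn.run_apply_eq {I : Interaction M T X K KA C R} {L : Log M T X}
    {s : R × Log M T X} (h : O.AgreeOn O' s.2) : O.run I L s = O'.run I L s := by
  induction I generalizing L with
  | output r => rfl
  | sample p next ih => exact bind_apply_congr fun n _ => ⟨rfl, ih n⟩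
  | compromiseAgent i next ih =>
    by_cases hL : L.corrupt (some i) ≤ s.2
    · simp only [run, h.key i (hL.1 (Finset.mem_insert_self _ _)), ih]
    · simp only [run, run_apply_eq_zero hL]
  | compromiseAggregator next ih =>
    by_cases hL : L.corrupt none ≤ s.2
    · simp only [run, h.aggr (hL.1 (Finset.mem_insert_self _ _)), ih]
    · simp only [run, run_apply_eq_zero hL]
  | encrypt q next ih =>
    by_cases hL : L.record q ≤ s.2
    · have henc : O.enc q.agent q.time = O'.enc q.agent q.time := h.enc q (hL.2 List.mem_cons_self)
      simp only [run, henc]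
      exact bind_apply_congr fun c₀ _ => ⟨rfl, bind_apply_congr fun c₁ _ => ⟨rfl, ih _⟩⟩
    · simp only [run, PMF.bind_apply, run_apply_eq_zero hL, mul_zero, tsum_zero]

section Finish

variable {ch : Challenge M T X} {next : (Fin M → Option C) → Interaction M T X K KA C Bool}
  {L : Log M T X} {b b' : Bool} {τ : Transcript M T X}

theorem eq_and_le_of_mem_support_finish (h : τ ∈ (O.finish ch next L b).support) :
    τ.challenge = ch ∧ L ≤ τ.log := by
  simp only [finish, PMF.mem_support_bind_iff, PMF.support_pure, Set.mem_singleton_iff] at h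
  obtain ⟨c, -, g, hg, rfl⟩ := h
  exact ⟨rfl, le_of_mem_support_run hg⟩

theorem AgreeOn.finish_apply_eq (h : O.AgreeOn O' τ.log) (hans : O.answer ch b = O'.answer ch b') :
    O.finish ch next L b τ = O'.finish ch next L b' τ := by
  refine bind_apply_congr fun c _ => ⟨by rw [hans], bind_apply_congr fun g hg => ⟨?_, rfl⟩⟩
  obtain rfl : τ = ⟨ch, g.1, g.2⟩ := by simpa using hg
  exact h.run_apply_eq

theorem AgreeOn.play_apply_eq {I : Player M T X K KA C} (h : O.AgreeOn O' τ.log)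
    (hans : O.answer τ.challenge b = O'.answer τ.challenge b') :
    O.play I b τ = O'.play I b' τ := by
  refine bind_apply_congr fun s hs => ?_
  obtain ⟨hch, hL⟩ : τ.challenge = s.1.1 ∧ s.2 ≤ τ.log :=
    hs.elim eq_and_le_of_mem_support_finish eq_and_le_of_mem_support_finish
  exact ⟨(h.mono hL).run_apply_eq, h.finish_apply_eq (hch ▸ hans)⟩

end Finish

end Oracle

end Oracle

namespace Scheme

variable {M T : ℕ} (𝒮 : Scheme M T)

/-- The challenger of a scheme who holds given keys. -/
noncomputable def oracle (prm : 𝒮.Prm) (sk : Fin M → 𝒮.AgentKey prm) (ska : 𝒮.AggrKey prm) :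
    Oracle M T (𝒮.Msg prm) (𝒮.AgentKey prm) (𝒮.AggrKey prm) (𝒮.Cipher prm) where
  key := sk
  aggr := ska
  enc := 𝒮.freshEnc prm sk

theorem run_eq_oracle_run {R : Type} (prm : 𝒮.Prm) (sk : Fin M → 𝒮.AgentKey prm)
    (ska : 𝒮.AggrKey prm) (I : 𝒮.Interacts prm R) (L : Log M T (𝒮.Msg prm)) :
    𝒮.run prm sk ska I L = (𝒮.oracle prm sk ska).run I L := by
  induction I generalizing L with
  | output r => rfl
  | sample p next ih => simp only [Scheme.run, Oracle.run, ih]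
  | compromiseAgent i _ ih => exact ih _ _
  | compromiseAggregator _ ih => exact ih _ _
  | encrypt q next ih => simp only [Scheme.run, Oracle.run, ih, oracle]

theorem game_eq_bind_oracle_game (A : 𝒮.Adversary) :
    𝒮.game A =
      𝒮.setup.bind fun keys => (𝒮.oracle keys.1 keys.2.1 keys.2.2).game (A keys.1) := by
  unfold Scheme.game
  congr 1
  funext keys
  rw [PMF.bind_comm]
  simp only [run_eq_oracle_run, Oracle.game, guessGame, Oracle.play, Oracle.finish, PMF.bind_bind,
    PMF.pure_bind]
  rfl

end Scheme

/-! ### Shares as one-time pads -/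

theorem exists_extension_sum_eq_zero {ι X : Type*} [Fintype ι] [AddCommGroup X]
    {S U : Finset ι} (hSU : S ⊆ U) (d : ι → X) (h : S = U → ∑ i ∈ S, d i = 0) :
    ∃ e : ι → X, (∀ i ∈ S, e i = d i) ∧ (∀ i ∉ U, e i = 0) ∧ ∑ i, e i = 0 := by
  classical
  obtain ⟨r, hr, hr_sum⟩ : ∃ r : ι → X, (∀ i ∉ U \ S, r i = 0) ∧ ∑ i, r i = -∑ i ∈ S, d i := by
    obtain rfl | hlt := hSU.eq_or_ssubset
    · exact ⟨0, fun _ _ => rfl, by simp [h rfl]⟩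
    · obtain ⟨j, hjU, hjS⟩ := Finset.exists_of_ssubset hlt
      refine ⟨Pi.single j (-∑ i ∈ S, d i), fun i hi => Pi.single_eq_of_ne ?_ _, by simp⟩
      rintro rfl
      exact hi (Finset.mem_sdiff.2 ⟨hjU, hjS⟩)
  refine ⟨fun i => (if i ∈ S then d i else 0) + r i, fun i hi => ?_, fun i hi => ?_, ?_⟩
  · simp [hi, hr i (by simp [hi])]
  · simp [show i ∉ S from fun hS => hi (hSU hS), hr i (by simp [hi])]
  · simp [Finset.sum_add_distrib, hr_sum]

section Shift

variable {M T : ℕ} {X : Type}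

theorem Log.notMem_untouched_of_corrupted {L : Log M T X} {j : Option (Fin M)}
    (hj : j ∈ L.corrupted) (t : Fin T) : j ∉ L.untouched t := by
  simp [Log.untouched, hj]

theorem Log.notMem_untouched_of_query {L : Log M T X} {q : EncQuery M T X} (hq : q ∈ L.queries) :
    some q.agent ∉ L.untouched q.time := by
  have hmem : some q.agent ∈ L.encrypted q.time := by
    simp only [Log.encrypted, List.mem_toFinset, List.mem_map, List.mem_filter,
      decide_eq_true_eq]
    exact ⟨q, ⟨hq, rfl⟩, rfl⟩
  simp [Log.untouched, hmem]

/-- A change `δ` of the agents' shares that affects nothing of what was revealed according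
to the log `L`. -/
structure Log.IsHiddenShift [AddCommMonoid X] (L : Log M T X) (δ : Fin M → Fin T → X) :
    Prop where
  corrupted : ∀ i, some i ∈ L.corrupted → δ i = 0
  aggregator : none ∈ L.corrupted → ∀ t, ∑ i, δ i t = 0
  queried : ∀ q ∈ L.queries, δ q.agent q.time = 0

variable [CommRing X]

/-- The difference of the plaintexts of agent `i` in the challenge, for the two bits. -/
def Challenge.gap (ch : Challenge M T X) (i : Fin M) : X :=
  ch.w false i * ch.x false i - ch.w true i * ch.x true i

variable {ch : Challenge M T X} {L : Log M T X}

theorem Legal.sum_gap_eq_zero (h : Legal ch L) (hS : ch.S = L.untouched ch.time)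
    (hn : none ∉ ch.S) : ∑ i ∈ ch.S.eraseNone, ch.gap i = 0 := by
  have hfilter : ch.S.eraseNone = Finset.univ.filter fun i => some i ∈ ch.S := by ext; simp
  simp only [hfilter, Challenge.gap, Finset.sum_sub_distrib, sub_eq_zero]
  exact h.balanced hS hn

-- The aggregator gets a component of its own, which is free if it is in `S⋆`, and which is zero,
-- so that the agents' components add up to zero, if it is compromised.
theorem Legal.exists_extension_gap (h : Legal ch L) :
    ∃ e : Option (Fin M) → X, (∀ i, some i ∈ ch.S → e (some i) = ch.gap i) ∧
      (∀ j ∉ L.untouched ch.time, e j = 0) ∧ ∑ j, e j = 0 := by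
  classical
  let d (j : Option (Fin M)) : X := j.elim (-∑ i ∈ ch.S.eraseNone, ch.gap i) ch.gap
  have hd : ch.S = L.untouched ch.time → ∑ j ∈ ch.S, d j = 0 := fun hS => by
    by_cases hn : none ∈ ch.S
    · rw [← Finset.insert_eq_of_mem hn, ← Finset.insertNone_eraseNone, Finset.sum_insertNone]
      simp [d]
    · rw [← Finset.erase_eq_of_notMem hn, ← Finset.map_some_eraseNone, Finset.sum_map]
      exact h.sum_gap_eq_zero hS hn
  obtain ⟨e, he, he_out, he_sum⟩ := exists_extension_sum_eq_zero h.subset d hd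
  exact ⟨e, fun i hi => he _ hi, he_out, he_sum⟩

theorem Legal.exists_isHiddenShift (h : Legal ch L) :
    ∃ δ : Fin M → Fin T → X, L.IsHiddenShift δ ∧
      ∀ i, some i ∈ ch.S → δ i ch.time = ch.gap i := by
  obtain ⟨e, he, he_out, he_sum⟩ := h.exists_extension_gap
  refine ⟨fun i => Pi.single ch.time (e (some i)), ⟨fun i hi => ?_, fun hn t => ?_, fun q hq => ?_⟩,
    fun i hi => (Pi.single_eq_same _ _).trans (he i hi)⟩
  · rw [he_out _ (L.notMem_untouched_of_corrupted hi _), Pi.single_zero]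
  · have he_agents : ∑ i, e (some i) = 0 := by
      rwa [Fintype.sum_option, he_out _ (L.notMem_untouched_of_corrupted hn _), zero_add] at he_sum
    obtain rfl | ht := eq_or_ne t ch.time
    · simpa using he_agents
    · simp [ht]
  · obtain ht | ht := eq_or_ne q.time ch.time
    · rw [he_out _ (ht ▸ L.notMem_untouched_of_query hq), Pi.single_zero, Pi.zero_apply]
    · exact Pi.single_eq_of_ne ht _

end Shift

section MaskedOracle

variable {M T : ℕ} {X K KA C : Type} [CommRing X] {key : (Fin T → X) → K}
  {aggr : (Fin T → X) → KA} {E : X → PMF C}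

/-- A challenger who masks the plaintext `w * x` of agent `i` at time `t` by the share `s i t`
before encrypting it by `E`; the secret keys are functions of the shares of their owners, and the
aggregator's shares make all shares add up to zero. -/
def maskedOracle (key : (Fin T → X) → K) (aggr : (Fin T → X) → KA) (E : X → PMF C)
    (s : Fin M → Fin T → X) : Oracle M T X K KA C where
  key i := key (s i)
  aggr := aggr fun t => -∑ i, s i t
  enc i t w x := E (w * x + s i t)

theorem maskedOracle_agreeOn_add {L : Log M T X} {δ : Fin M → Fin T → X}
    (hδ : L.IsHiddenShift δ) (s : Fin M → Fin T → X) :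
    (maskedOracle key aggr E s).AgreeOn (maskedOracle key aggr E (s + δ)) L where
  key i hi := by simp [maskedOracle, hδ.corrupted i hi]
  aggr hn := by simp [maskedOracle, Finset.sum_add_distrib, hδ.aggregator hn]
  enc q hq := by simp [maskedOracle, hδ.queried q hq]

theorem maskedOracle_answer_add {ch : Challenge M T X} {δ : Fin M → Fin T → X}
    (hδ : ∀ i, some i ∈ ch.S → δ i ch.time = ch.gap i) (s : Fin M → Fin T → X) :
    (maskedOracle key aggr E s).answer ch false =
      (maskedOracle key aggr E (s + δ)).answer ch true := by
  unfold Oracle.answer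
  congr 1
  funext i
  refine if_ctx_congr Iff.rfl (fun hi => ?_) fun _ => rfl
  have hplain : ch.w true i * ch.x true i + (s + δ) i ch.time =
      ch.w false i * ch.x false i + s i ch.time := by
    rw [Pi.add_apply, Pi.add_apply, hδ i hi, Challenge.gap]
    ring
  simp only [maskedOracle, hplain]

theorem uniform_bind_maskedOracle_game [Fintype X] (I : Player M T X K KA C) :
    ((PMF.uniformOfFintype (Fin M → Fin T → X)).bind fun s =>
      (maskedOracle key aggr E s).game I) = PMF.uniformOfFintype Bool := by
  simp only [Oracle.game, bind_guessGame]
  refine guessGame_eq_uniform fun τ hτ => ?_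
  obtain ⟨δ, hδ, hgap⟩ := hτ.exists_isHiddenShift
  have hplay : ∀ s, (maskedOracle key aggr E s).play I false τ =
      (maskedOracle key aggr E (s + δ)).play I true τ := fun s =>
    (maskedOracle_agreeOn_add hδ s).play_apply_eq (maskedOracle_answer_add hgap s)
  conv_rhs => rw [← uniformOfFintype_map_equiv (Equiv.addRight δ), PMF.bind_map]
  exact bind_apply_congr fun s _ => ⟨rfl, hplay s⟩

end MaskedOracle

/-! ### Paillier ciphertexts -/

theorem pow_self_modEq_sq {N m n : ℕ} (h : m ≡ n [MOD N]) : m ^ N ≡ n ^ N [MOD N ^ 2] := by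
  have hdvd : (N : ℤ) ∣ (n : ℤ) - m := Nat.modEq_iff_dvd.1 h
  have hdvd_pow := dvd_sub_pow_of_dvd_sub hdvd 1
  rw [pow_one, one_add_one_eq_two] at hdvd_pow
  exact Nat.modEq_iff_dvd.2 (mod_cast hdvd_pow)

theorem one_add_natCast_pow_self (N : ℕ) : (1 + (N : ZMod (N ^ 2))) ^ N = 1 := by
  have h : (1 + N) ^ N ≡ 1 ^ N [MOD N ^ 2] := pow_self_modEq_sq (by simp [Nat.ModEq])
  simpa using (ZMod.natCast_eq_natCast_iff _ _ _).2 h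

theorem paillierEncWith_zero_one (N : ℕ+) : paillierEncWith N 0 1 = 1 := by
  have h : (1 : ZMod N).val ^ (N : ℕ) ≡ 1 ^ (N : ℕ) [MOD N ^ 2] :=
    pow_self_modEq_sq ((ZMod.natCast_eq_natCast_iff _ _ _).1 (by simp))
  simpa [paillierEncWith] using (ZMod.natCast_eq_natCast_iff _ _ _).2 h

theorem paillierEncWith_mul (N : ℕ+) (x y : ZMod N) (r u : (ZMod N)ˣ) :
    paillierEncWith N x r * paillierEncWith N y u = paillierEncWith N (x + y) (r * u) := by
  have hplain : (1 + ((N : ℕ) : ZMod ((N : ℕ) ^ 2))) ^ (x + y).val =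
      (1 + ((N : ℕ) : ZMod ((N : ℕ) ^ 2))) ^ (x.val + y.val) :=
    pow_eq_pow_of_modEq ((ZMod.natCast_eq_natCast_iff _ _ _).1 (by simp))
      (one_add_natCast_pow_self N)
  have hnonce : (((r * u : (ZMod N)ˣ) : ZMod N).val : ZMod ((N : ℕ) ^ 2)) ^ (N : ℕ) =
      (((r : ZMod N).val * (u : ZMod N).val : ℕ) : ZMod ((N : ℕ) ^ 2)) ^ (N : ℕ) := by
    exact_mod_cast (ZMod.natCast_eq_natCast_iff _ _ _).2
      (pow_self_modEq_sq ((ZMod.natCast_eq_natCast_iff _ _ _).1 (by simp)))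
  rw [paillierEncWith, paillierEncWith, paillierEncWith, hplain, hnonce]
  push_cast
  ring

theorem paillierEncWith_pow (N : ℕ+) (x : ZMod N) (r : (ZMod N)ˣ) (n : ℕ) :
    paillierEncWith N x r ^ n = paillierEncWith N (n * x) (r ^ n) := by
  induction n with
  | zero => simp [paillierEncWith_zero_one]
  | succ n ih =>
    rw [pow_succ (paillierEncWith N x r), ih, paillierEncWith_mul, pow_succ r, Nat.cast_succ,
      add_one_mul]

theorem paillierEnc_map_mul (N : ℕ+) (x y : ZMod N) (r : (ZMod N)ˣ) :
    ((paillierEnc N y).map fun c => paillierEncWith N x r * c) = paillierEnc N (x + y) := by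
  unfold paillierEnc
  conv_rhs => rw [← uniformOfFintype_map_equiv (Equiv.mulLeft r), PMF.map_comp]
  rw [PMF.map_comp]
  congr 1
  funext u
  exact paillierEncWith_mul N x y r u

theorem paillierEnc_bind_pow_mul (N : ℕ+) (w x s : ZMod N) :
    ((paillierEnc N w).bind fun sw => (paillierEnc N s).map fun c => sw ^ x.val * c) =
      paillierEnc N (w * x + s) := by
  conv_lhs => rw [paillierEnc, PMF.bind_map]
  simp only [Function.comp_def, paillierEncWith_pow, ZMod.natCast_zmod_val, paillierEnc_map_mul,
    PMF.bind_const, mul_comm x w]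

/-! ### The game of the scheme -/

section Game

variable {M T : ℕ}

/-- A family of units of `ℤ/N`, seen as a family of elements. -/
def coeUnits (M T : ℕ) (N : ℕ+) :
    (Fin M → Fin T → (ZMod N)ˣ) ↪ (Fin M → Fin T → ZMod N) where
  toFun s i t := s i t
  inj' s s' h := by
    funext i t
    exact Units.ext (congrFun (congrFun h i) t)

open Classical in
/-- The challenger of the scheme `pWSAh`, for arbitrary shares in `ℤ/N`. An agent's key consists of
units, so that a share which is not a unit is replaced by the dummy `1` in it. -/
noncomputable def paillierOracle (N : ℕ+) (s : Fin M → Fin T → ZMod N) :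
    Oracle M T (ZMod N) (Fin T → (ZMod N)ˣ) ((ℕ × ZMod N) × (Fin T → ZMod N))
      (ZMod ((N : ℕ) ^ 2)) :=
  maskedOracle (fun σ t => if h : IsUnit (σ t) then h.unit else 1)
    (fun σ => (paillierSecret N, σ)) (paillierEnc N) s

theorem pWSAh_oracle (gen : PMF PaillierPrimes) (κ : ℕ) (prm : ℕ × ℕ+)
    (s : Fin M → Fin T → (ZMod prm.2)ˣ) :
    (pWSAh gen κ M T).oracle prm s (paillierSecret prm.2, aggregatorShare prm.2 s) =
      paillierOracle prm.2 (coeUnits M T prm.2 s) := by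
  unfold paillierOracle maskedOracle Scheme.oracle
  congr 1
  · funext i t
    exact ((dif_pos (s i t).isUnit).trans (IsUnit.unit_of_val_units _)).symm
  · funext i t w x
    exact paillierEnc_bind_pow_mul prm.2 w x (s i t)

theorem pWSAh_game (gen : PMF PaillierPrimes) (κ : ℕ) (A : (pWSAh gen κ M T).Adversary) :
    (pWSAh gen κ M T).game A = gen.bind fun k =>
      (PMF.uniformOfFintype (Fin M → Fin T → (ZMod k.modulus)ˣ)).bind fun s =>
        (paillierOracle k.modulus (coeUnits M T k.modulus s)).game (A (κ, k.modulus)) := by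
  rw [Scheme.game_eq_bind_oracle_game]
  refine (PMF.bind_bind _ _ _).trans (congrArg gen.bind (funext fun k => ?_))
  refine (PMF.bind_map _ _ _).trans (congrArg (PMF.bind _) (funext fun s => ?_))
  rw [← pWSAh_oracle gen κ (κ, k.modulus) s]
  rfl

theorem paillierOracle_game_le (N : ℕ+)
    (I : Player M T (ZMod N) (Fin T → (ZMod N)ˣ) ((ℕ × ZMod N) × (Fin T → ZMod N))
      (ZMod ((N : ℕ) ^ 2))) (v : Bool) :
    (((PMF.uniformOfFintype (Fin M → Fin T → (ZMod N)ˣ)).bind fun s =>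
      (paillierOracle N (coeUnits M T N s)).game I) v).toReal ≤
        1 / 2 + (M * T : ℕ) * (1 - (Nat.totient N : ℝ) / N) := by
  set y : ℝ := (Nat.totient N : ℝ) / N with hy
  have hdensity : (Fintype.card (Fin M → Fin T → (ZMod N)ˣ) : ℝ) /
      Fintype.card (Fin M → Fin T → ZMod N) = y ^ (M * T) := by
    simp [hy, ZMod.card_units_eq_totient, ZMod.card, div_pow, ← pow_mul, mul_comm M T]
  have hbernoulli : 1 + (M * T : ℕ) * (y - 1) ≤ y ^ (M * T) :=
    one_add_mul_sub_le_pow (by linarith [show 0 ≤ y by positivity]) _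
  have huniform : (((PMF.uniformOfFintype (Fin M → Fin T → ZMod N)).bind fun s =>
      (paillierOracle N s).game I) v).toReal = 1 / 2 := by
    unfold paillierOracle
    rw [uniform_bind_maskedOracle_game]
    simp
  have hrestrict := toReal_uniformOfFintype_bind_embedding_le (coeUnits M T N)
    (fun s => (paillierOracle N s).game I) v
  rw [huniform, hdensity] at hrestrict
  linarith

theorem pWSAh_advantage_le {gen : PMF PaillierPrimes} {ε : ℝ}
    (hgen : ∀ k ∈ gen.support, 1 - (Nat.totient k.modulus : ℝ) / k.modulus ≤ ε) (κ : ℕ)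
    (A : (pWSAh gen κ M T).Adversary) :
    (pWSAh gen κ M T).advantage A ≤ (M * T : ℕ) * ε := by
  refine abs_toReal_apply_true_sub_half_le fun v => ?_
  rw [pWSAh_game]
  refine toReal_bind_apply_le fun k hk => (paillierOracle_game_le _ _ v).trans ?_
  gcongr
  exact hgen k hk

end Game

/-! ### The density of the units -/

theorem one_sub_totient_mul_div_le {p q : ℕ} (hp : p.Prime) (hq : q.Prime) (hpq : p ≠ q) :
    1 - (Nat.totient (p * q) : ℝ) / (p * q : ℕ) ≤ 1 / p + 1 / q := by
  have hp0 : (0 : ℝ) < p := by exact_mod_cast hp.pos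
  have hq0 : (0 : ℝ) < q := by exact_mod_cast hq.pos
  have htotient : (Nat.totient (p * q) : ℝ) = (p - 1) * (q - 1) := by
    rw [Nat.totient_mul ((Nat.coprime_primes hp hq).2 hpq), Nat.totient_prime hp,
      Nat.totient_prime hq]
    push_cast [hp.one_le, hq.one_le]
    ring
  calc 1 - (Nat.totient (p * q) : ℝ) / (p * q : ℕ) = 1 / p + 1 / q - 1 / (p * q) := by
        rw [htotient]
        push_cast
        field_simp
        ring
    _ ≤ 1 / p + 1 / q := sub_le_self _ (by positivity)

theorem lt_two_mul_of_size_eq {p q : ℕ} (hp : 0 < p) (h : p.size = q.size) : q < 2 * p := by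
  obtain ⟨n, hn⟩ := Nat.exists_eq_succ_of_ne_zero (Nat.size_pos.2 hp).ne'
  calc q < 2 ^ (n + 1) := Nat.size_le.1 (h ▸ hn).le
    _ = 2 * 2 ^ n := pow_succ' 2 n
    _ ≤ 2 * p := Nat.mul_le_mul_left 2 (Nat.lt_size.1 (by omega))

theorem one_div_le_of_size_eq {p q n : ℕ} (hsize : p.size = q.size) (h : 2 ^ n ≤ p * q) :
    1 / (p : ℝ) ≤ 2 / √2 ^ n := by
  have hp : 0 < p := Nat.pos_of_mul_pos_right ((Nat.two_pow_pos n).trans_le h)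
  have hsq : (√2 ^ n) ^ 2 ≤ (2 * (p : ℝ)) ^ 2 :=
    calc (√2 ^ n) ^ 2 = ((2 ^ n : ℕ) : ℝ) := by
          rw [pow_right_comm, Real.sq_sqrt zero_le_two, Nat.cast_pow, Nat.cast_ofNat]
      _ ≤ (((2 * p) ^ 2 : ℕ) : ℝ) := by
          exact_mod_cast h.trans (by nlinarith [lt_two_mul_of_size_eq hp hsize])
      _ = (2 * (p : ℝ)) ^ 2 := by push_cast; rfl
  rw [div_le_div_iff₀ (by exact_mod_cast hp) (by positivity), one_mul]
  exact le_of_sq_le_sq hsq (by positivity)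

namespace PaillierPrimes

variable (k : PaillierPrimes)

theorem p_ne_q : k.p ≠ k.q := by
  intro h
  have hp : k.p ∣ Nat.gcd (Nat.totient (k.p * k.q)) (k.p * k.q) := by
    rw [← h, Nat.totient_mul_of_prime_of_dvd k.prime_p dvd_rfl]
    exact Nat.dvd_gcd (Nat.dvd_mul_right _ _) (Nat.dvd_mul_right _ _)
  exact k.prime_p.one_lt.ne' (Nat.dvd_one.1 (k.coprime ▸ hp))

theorem one_sub_totient_div_le {n : ℕ} (h : 2 ^ n ≤ k.p * k.q) :
    1 - (Nat.totient k.modulus : ℝ) / k.modulus ≤ 4 / √2 ^ n :=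
  calc 1 - (Nat.totient k.modulus : ℝ) / k.modulus ≤ 1 / k.p + 1 / k.q :=
        one_sub_totient_mul_div_le k.prime_p k.prime_q k.p_ne_q
    _ ≤ 2 / √2 ^ n + 2 / √2 ^ n :=
        add_le_add (one_div_le_of_size_eq k.equal_size h)
          (one_div_le_of_size_eq k.equal_size.symm (mul_comm k.p k.q ▸ h))
    _ = 4 / √2 ^ n := by ring

end PaillierPrimes

/-! ### Negligible functions -/

theorem negligible_iff_superpolynomialDecay {f : ℕ → ℝ} :
    Negligible f ↔ SuperpolynomialDecay atTop (fun n : ℕ => (n : ℝ)) f := by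
  constructor
  · intro hf
    refine (superpolynomialDecay_iff_isBigO f tendsto_natCast_atTop_atTop).2 fun z => ?_
    obtain ⟨n₀, hn₀, hle⟩ := hf (max (-z) 1) (lt_max_of_lt_right one_pos)
    refine IsBigO.of_bound 1 (eventually_atTop.2 ⟨n₀, fun n hn => ?_⟩)
    have hn_one : (1 : ℝ) ≤ n := by exact_mod_cast hn₀.trans hn
    rw [one_mul, Real.norm_eq_abs, Real.norm_of_nonneg (by positivity), ← Real.rpow_intCast]
    refine (hle n hn).trans (Real.rpow_le_rpow_of_exponent_le hn_one ?_)
    linarith [le_max_left (-z : ℝ) 1]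
  · intro hf c _
    obtain ⟨m, hm⟩ := exists_nat_ge c
    have habs := (superpolynomialDecay_iff_abs_tendsto_zero atTop _ f).1 hf m
    obtain ⟨n₀, hn₀⟩ := eventually_atTop.1 (habs.eventually_le_const one_pos)
    refine ⟨max n₀ 1, le_max_right _ _, fun n hn => ?_⟩
    have hn_one : (1 : ℝ) ≤ n := by exact_mod_cast (le_max_right _ _).trans hn
    have hbound : (n : ℝ) ^ m * |f n| ≤ 1 := by
      simpa [abs_mul] using hn₀ n ((le_max_left _ _).trans hn)
    calc |f n| ≤ 1 / (n : ℝ) ^ m := by rwa [le_div_iff₀' (by positivity)]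
      _ = (n : ℝ) ^ (-(m : ℝ)) := by
        rw [Real.rpow_neg (by positivity), Real.rpow_natCast, one_div]
      _ ≤ (n : ℝ) ^ (-c) := Real.rpow_le_rpow_of_exponent_le hn_one (neg_le_neg hm)

theorem PolyBounded.mul {f g : ℕ → ℕ} (hf : PolyBounded f) (hg : PolyBounded g) :
    PolyBounded fun κ => f κ * g κ := by
  obtain ⟨P, hP⟩ := hf
  obtain ⟨Q, hQ⟩ := hg
  exact ⟨P * Q, fun κ => by simpa using Nat.mul_le_mul (hP κ) (hQ κ)⟩

theorem PolyBounded.negligible_div_pow {f : ℕ → ℕ} (hf : PolyBounded f) {r : ℝ} (hr : 1 < r) :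
    Negligible fun κ => (f κ : ℝ) / r ^ κ := by
  obtain ⟨P, hP⟩ := hf
  have : 0 < r := one_pos.trans hr
  have hinv : SuperpolynomialDecay atTop (fun n : ℕ => (n : ℝ)) fun n => (r ^ n)⁻¹ := fun m => by
    simpa [div_eq_mul_inv] using tendsto_pow_const_div_const_pow_of_one_lt m hr
  refine negligible_iff_superpolynomialDecay.2
    ((hinv.polynomial_mul (P.map (Nat.castRingHom ℝ))).trans_abs_le fun κ => ?_)
  rw [Polynomial.eval_natCast_map, ← div_eq_mul_inv, abs_of_nonneg (by positivity)]
  refine le_trans ?_ (le_abs_self _)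
  gcongr
  exact Nat.cast_le.2 (hP κ)

end PWSA

theorem theorem1_general (M T : ℕ → ℕ)
    (hMT : PWSA.Negligible fun κ => ((M κ * T κ : ℕ) : ℝ) / √2 ^ κ)
    (gen : ℕ → PMF PWSA.PaillierPrimes)
    (hgen : ∀ᶠ κ in Filter.atTop, ∀ k ∈ (gen κ).support, 2 ^ κ ≤ k.p * k.q) :
    PWSA.AggregatorOblivious fun κ => PWSA.pWSAh (gen κ) κ (M κ) (T κ) := by
  refine fun A => ⟨_, PWSA.negligible_iff_superpolynomialDecay.2 ?_, fun κ => le_rfl⟩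
  refine ((PWSA.negligible_iff_superpolynomialDecay.1 hMT).const_mul 4).trans_eventually_abs_le ?_
  filter_upwards [hgen] with κ hκ
  have hadv : (PWSA.pWSAh (gen κ) κ (M κ) (T κ)).advantage (A κ) ≤
      (M κ * T κ : ℕ) * (4 / √2 ^ κ) :=
    PWSA.pWSAh_advantage_le (fun k hk => k.one_sub_totient_div_le (hκ k hk)) κ (A κ)
  rw [mul_div_left_comm] at hadv
  exact abs_le_abs_of_nonneg (abs_nonneg _) hadv

theorem theorem1 (M T : ℕ → ℕ) (hM : PWSA.PolyBounded M) (hT : PWSA.PolyBounded T)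
    (gen : ℕ → PMF PWSA.PaillierPrimes)
    (hgen : ∀ᶠ κ in Filter.atTop, ∀ k ∈ (gen κ).support, Nat.log 2 (k.p * k.q) = κ) :
    PWSA.AggregatorOblivious fun κ => PWSA.pWSAh (gen κ) κ (M κ) (T κ) :=
  theorem1_general M T ((hM.mul hT).negligible_div_pow Real.one_lt_sqrt_two) gen <|
    hgen.mono fun _ h k hk => h k hk ▸ Nat.pow_log_le_self 2 k.modulus.ne_zero
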